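/- Let $K$ be a number field with ring of integers $\mathcal{O}_K$, degree $n=[K:\mathbb{Q}]$, discriminant $d_K$, class number $h_K$ and $r_2$ pairs of complex embeddings. An ideal $\mathfrak{a}\subseteq\mathcal{O}_K$ is called \emph{inseverable} if the only principal ideal dividing it is $\mathcal{O}_K$. A fraction $a/b$ with $a,b\in\mathcal{O}_K$, $b\neq 0$, is called \emph{reduced} if every common divisor of $a$ and $b$ in $\mathcal{O}_K$ is a unit. Let $$\mathcal{I}_K=\{(a,b) : b\in(\mathcal{O}_K\setminus\{0\})/\mathcal{O}_K^\times,\ a\in\mathcal{O}_K/b\mathcal{O}_K,\ a/b \text{ is reduced}\},\qquad \mathscr{C}_K=\{(a,b)\in\mathcal{I}_K : \langle a,b\rangle=\mathcal{O}_K\}.$$ Let $\mathcal{R}_K$ be a system of representatives of the ideal class group of $K$ consisting of inseverable integral ideals. Then the natural density $$\delta=\lim_{N\to\infty}\frac{\#\{(a,b)\in\mathscr{C}_K : |\mathrm{Norm}_{K/\mathbb{Q}}(b)|\le N\}}{\#\{(a,b)\in\mathcal{I}_K : \langle a,b\rangle\in\mathcal{R}_K,\ |\mathrm{Norm}_{K/\mathbb{Q}}(b)|\le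 N\}}$$ of the coprime fractions among the reduced fractions with respect to $\mathcal{R}_K$ exists and satisfies the following. 1. $\displaystyle \delta\ge\frac{4}{3+h_K}$. 2. If $B\in\mathbb{N}$ is such that no non-principal ideal $\mathfrak{a}\subseteq\mathcal{O}_K$ has norm $\le B$, then $\displaystyle \delta\ge\frac{(B+1)^2}{B^2+2B+h_K}$. 3. If every element of $\mathcal{R}_K$ has minimal norm among the integral ideals in its ideal class, then $$\delta\le\frac{1}{1+\frac{h_K-1}{|d_K|}\left(\frac{n^n\pi^{r_2}}{n!\,4^{r_2}}\right)^2}.$$ -/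

import Mathlib

open Filter Topology NumberField
open scoped nonZeroDivisors

/-! ### Natural density of a set ordered by an attribute -/

/-- The number of elements `x ∈ A` with attribute `κ x = n`. -/
noncomputable def attributeCount {α : Type*} (κ : α → ℕ) (A : Set α) (n : ℕ) : ℕ :=
  {x ∈ A | κ x = n}.ncard

/-- `B` has natural density `δ` in `A`, where the elements are ordered by the attribute `κ`. -/
def HasNaturalDensity {α : Type*} (κ : α → ℕ) (A B : Set α) (δ : ℝ) : Prop :=
  Tendsto (fun N : ℕ =>
    (∑ n ∈ Finset.Icc 1 N, (attributeCount κ B n : ℝ)) /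
      (∑ n ∈ Finset.Icc 1 N, (attributeCount κ A n : ℝ))) atTop (𝓝 δ)

/-! ### Reduced fractions and inseverable ideals -/

/-- The fraction `a / b` (with `b ≠ 0`) is reduced: only units divide both `a` and `b`. -/
def IsReducedFraction {R : Type*} [CommRing R] (a b : R) : Prop :=
  b ≠ 0 ∧ ∀ c : R, c ∣ a → c ∣ b → IsUnit c

/-- An ideal is inseverable if the only principal ideal dividing it is the whole ring. -/
def IsInseverable {R : Type*} [CommRing R] (𝔞 : Ideal R) : Prop :=
  ∀ I : Ideal R, I.IsPrincipal → I ∣ 𝔞 → I = ⊤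

namespace NumberFieldFractions

variable (K : Type*) [Field K]

/-- The set `(𝓞 K \ {0}) / (𝓞 K)ˣ` of denominators. -/
abbrev Denominator : Type _ := {b : Associates (𝓞 K) // b ≠ 0}

variable {K}

/-- The principal ideal `⟨b⟩` generated by a denominator. -/
noncomputable def Denominator.ideal (b : Denominator K) : Ideal (𝓞 K) :=
  (Ideal.associatesEquivIsPrincipal (𝓞 K) b.1 : Ideal (𝓞 K))

theorem Denominator.ideal_mk (b : 𝓞 K) (hb : Associates.mk b ≠ 0) :
    Denominator.ideal (K := K) ⟨Associates.mk b, hb⟩ = Ideal.span {b} :=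
  Ideal.associatesEquivIsPrincipal_apply (R := 𝓞 K) b

theorem Denominator.ideal_eq {d : Denominator K} {b : 𝓞 K} (h : Associates.mk b = d.1) :
    d.ideal = Ideal.span {b} := by
  obtain ⟨_, hd⟩ := d
  subst h
  exact Denominator.ideal_mk b hd

/-- The absolute value of the norm of a denominator. -/
noncomputable def Denominator.norm [NumberField K] (b : Denominator K) : ℕ := Ideal.absNorm b.ideal

theorem Denominator.norm_eq [NumberField K] {d : Denominator K} {b : 𝓞 K} (h : Associates.mk b = d.1) :
    d.norm = (Algebra.norm ℤ b).natAbs := by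
  rw [Denominator.norm, Denominator.ideal_eq h, Ideal.absNorm_span_singleton]

variable (K)

/-- Pairs `(a, b)` of a denominator `b` (up to units) and a numerator `a` modulo `b`. -/
abbrev FractionPair : Type _ := Σ b : Denominator K, 𝓞 K ⧸ b.ideal

variable {K}

/-- `a` and `b` are representatives of the two entries of the pair `y`. -/
def FractionPair.Represents (y : FractionPair K) (a b : 𝓞 K) : Prop :=
  Associates.mk b = y.1.1 ∧ Ideal.Quotient.mk y.1.ideal a = y.2

/-- The ideal `⟨a, b⟩` of a pair `(a, b)`: the preimage in `𝓞 K` of the ideal of `𝓞 K / ⟨b⟩`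
generated by the numerator. -/
noncomputable def FractionPair.gcdIdeal (y : FractionPair K) : Ideal (𝓞 K) :=
  (Ideal.span {y.2}).comap (Ideal.Quotient.mk y.1.ideal)

theorem FractionPair.Represents.gcdIdeal_eq {y : FractionPair K} {a b : 𝓞 K}
    (h : y.Represents a b) : y.gcdIdeal = Ideal.span {a, b} := by
  rw [FractionPair.gcdIdeal, ← h.2, ← Set.image_singleton, ← Ideal.map_span,
    Ideal.comap_map_of_surjective _ Ideal.Quotient.mk_surjective, ← RingHom.ker_eq_comap_bot,
    Ideal.mk_ker, Denominator.ideal_eq h.1, ← Ideal.span_union]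
  rfl

/-- The denominator of a pair, as an attribute: `κ (a, b) = N b`. -/
noncomputable def FractionPair.kappa [NumberField K] (y : FractionPair K) : ℕ := y.1.norm

variable (K)

/-- The set of pairs `(a mod b, b mod units)` such that `a / b` is a reduced fraction. -/
def reducedFractions : Set (FractionPair K) :=
  {y | ∃ a b : 𝓞 K, y.Represents a b ∧ IsReducedFraction a b}

/-- The set of coprime reduced fractions: those with `⟨a, b⟩ = 𝓞 K`. -/
def coprimeFractions : Set (FractionPair K) :=
  {y ∈ reducedFractions K | y.gcdIdeal = ⊤}

variable {K}

/-- Being reduced does not depend on the chosen representatives. -/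
theorem mem_reducedFractions_iff {y : FractionPair K} {a b : 𝓞 K} (h : y.Represents a b) :
    y ∈ reducedFractions K ↔ IsReducedFraction a b := by
  have key : ∀ {a b : 𝓞 K}, y.Represents a b →
      (IsReducedFraction a b ↔ ∀ c : 𝓞 K, y.gcdIdeal ≤ Ideal.span {c} → IsUnit c) := by
    intro a b h
    have hb : b ≠ 0 := fun h0 => y.1.2 (by rw [← h.1, h0]; exact Associates.mk_zero)
    simp only [IsReducedFraction, h.gcdIdeal_eq, Ideal.span_le, Set.insert_subset_iff,
      Set.singleton_subset_iff, SetLike.mem_coe, Ideal.mem_span_singleton, and_imp, ne_eq, hb,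
      not_false_eq_true, true_and]
  constructor
  · rintro ⟨a', b', h', hr⟩
    exact (key h).2 ((key h').1 hr)
  · exact fun hr => ⟨a, b, h, hr⟩

/-- The reduced fractions that are counted with respect to a set `ℛ` of ideals: those for which
`⟨a, b⟩` belongs to `ℛ`. -/
def reducedFractionsWrt (ℛ : Set (Ideal (𝓞 K))⁰) : Set (FractionPair K) :=
  {y ∈ reducedFractions K | ∃ 𝔤 ∈ ℛ, y.gcdIdeal = (𝔤 : Ideal (𝓞 K))}

/-- `ℛ` is a system of (integral) representatives of the ideal class group of `K`. -/
def IsRepresentativeSystem [NumberField K] (ℛ : Set (Ideal (𝓞 K))⁰) : Prop :=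
  Set.BijOn (fun 𝔤 : (Ideal (𝓞 K))⁰ => ClassGroup.mk0 𝔤) ℛ Set.univ

/-- The integral ideal `𝔤` has minimal norm among the integral ideals in its class. -/
def HasMinimalNorm [NumberField K] (𝔤 : (Ideal (𝓞 K))⁰) : Prop :=
  ∀ 𝔞 : (Ideal (𝓞 K))⁰, ClassGroup.mk0 𝔞 = ClassGroup.mk0 𝔤 →
    Ideal.absNorm (𝔤 : Ideal (𝓞 K)) ≤ Ideal.absNorm (𝔞 : Ideal (𝓞 K))

end NumberFieldFractions

/-!
The density is `δ = 1 / ∑ N 𝔤⁻²`, the sum running over the representatives `𝔤 ∈ ℛ`; the three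
bounds follow from estimates of the norms `N 𝔤`.

Fix an ideal `J`. The fractions `a / b` with `⟨a, b⟩ = J` are counted by Möbius inversion over
finite sets `s` of primes, with `d s = ∏ v ∈ s, v`: their number is the alternating sum over `s`
of the numbers of fractions with `J d(s) ∣ ⟨a, b⟩` (`card_pairsLE_gcdIdeal_eq`). If
`⟨b⟩ = J d(s) e`, exactly `N e` numerators modulo `b` are divisible by `J d(s)`. Hence, with
denominators of norm at most `x`, such a number is the sum of `N e` over the ideals `e` of norm at
most `x / N(J d(s))` in a fixed ideal class
(`card_pairsLE_gcdIdeal_le`).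

The ideals in a class have an asymptotic density which is independent of the class. Abel summation
therefore gives `∑ N e ~ c x²` for the ideals of norm at most `x` in a class, with `c` independent
of the class. As these sums are also `O(x²)` and `∑ N v⁻²` converges, the limit may be taken
inside the sum over `s`, and the number of fractions with `⟨a, b⟩ = J` is asymptotic to
`c ∏ (1 - N v⁻²) · (x / N J)²` (`exists_tendsto_card_gcdIdeal_eq`). The Euler product does not vanish and
cancels in the quotient. Fractions whose ideal is inseverable are automatically reduced, and the
trivial ideal is the representative of the principal class, which yields `δ`
(`hasNaturalDensity_coprimeFractions`).

Finally, the `h - 1` other representatives are not principal, so their norms are at least `B + 1`;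
if they have minimal norm in their classes, Minkowski's theorem bounds their norms from above.
-/

/-! ### Sums of attributes from their counting function -/

section Counting

variable {ι : Type*} {p : ι → Prop} {ν : ι → ℕ} {E : ℕ → Finset ι}

/-- Abel summation for the sum of the attributes. -/
theorem sum_attribute_eq (hE : ∀ N i, i ∈ E N ↔ p i ∧ ν i ≤ N) (N : ℕ) :
    ∑ i ∈ E N, (ν i : ℝ) = N * (E N).card - ∑ k ∈ Finset.range N, ((E k).card : ℝ) := by
  classical
  have h1 : ∀ k ∈ Finset.range N, ((E k).card : ℝ) = ∑ i ∈ E N, if ν i ≤ k then (1 : ℝ) else 0 := by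
    intro k hk
    rw [Finset.sum_boole]
    congr 2
    ext i
    rw [Finset.mem_filter, hE, hE]
    have := Finset.mem_range.1 hk
    constructor
    · rintro ⟨a, b⟩; exact ⟨⟨a, by omega⟩, b⟩
    · rintro ⟨⟨a, _⟩, b⟩; exact ⟨a, b⟩
  rw [Finset.sum_congr rfl h1, Finset.sum_comm, eq_sub_iff_add_eq, ← Finset.sum_add_distrib,
    mul_comm, ← nsmul_eq_mul, ← Finset.sum_const]
  refine Finset.sum_congr rfl fun i hi => ?_
  rw [Finset.sum_boole]
  have h2 : (Finset.range N).filter (fun k => ν i ≤ k) = Finset.Ico (ν i) N := by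
    ext k; simp [and_comm]
  rw [h2, Nat.card_Ico, ← Nat.cast_add]
  have := ((hE N i).1 hi).2
  congr 1; omega

/-- If `#{ν ≤ N} ~ c N`, then `∑_{ν ≤ N} ν ~ c N² / 2`. -/
theorem tendsto_sum_attribute_div_sq (hE : ∀ N i, i ∈ E N ↔ p i ∧ ν i ≤ N) {c : ℝ}
    (hc : Tendsto (fun N : ℕ => ((E N).card : ℝ) / N) atTop (𝓝 c)) :
    Tendsto (fun N : ℕ => (∑ i ∈ E N, (ν i : ℝ)) / (N : ℝ) ^ 2) atTop (𝓝 (c / 2)) := by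
  have hid : Tendsto (fun N : ℕ => (∑ k ∈ Finset.range N, (k : ℝ)) / (N : ℝ) ^ 2) atTop
      (𝓝 (1 / 2)) := by
    have h1 : Tendsto (fun N : ℕ => (1 / 2 : ℝ) - 1 / 2 * ((N : ℝ))⁻¹) atTop
        (𝓝 (1 / 2 - 1 / 2 * 0)) :=
      tendsto_const_nhds.sub (tendsto_const_nhds.mul tendsto_inv_atTop_nhds_zero_nat)
    rw [mul_zero, sub_zero] at h1
    refine h1.congr' ?_
    filter_upwards [eventually_gt_atTop 0] with N hN
    have h2 : (∑ k ∈ Finset.range N, (k : ℝ)) = N * (N - 1) / 2 := by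
      have := Finset.sum_range_id_mul_two N
      have h3 : ((∑ k ∈ Finset.range N, k : ℕ) : ℝ) * 2 = N * (N - 1) := by
        rw [← Nat.cast_ofNat, ← Nat.cast_mul, this, Nat.cast_mul, Nat.cast_sub hN, Nat.cast_one]
      rw [← Nat.cast_sum]
      linarith
    rw [h2]
    have : (N : ℝ) ≠ 0 := by positivity
    field_simp
  have hlo : (fun k : ℕ => ((E k).card : ℝ) - c * k) =o[atTop] fun k : ℕ => (k : ℝ) := by
    rw [Asymptotics.isLittleO_iff_tendsto']
    · have := hc.sub_const c
      rw [sub_self] at this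
      refine this.congr' ?_
      filter_upwards [eventually_gt_atTop 0] with N hN
      have : (N : ℝ) ≠ 0 := by positivity
      field_simp
    · filter_upwards [eventually_gt_atTop 0] with N hN h0
      exact absurd h0 (by positivity)
  have hdiv : Tendsto (fun N : ℕ => ∑ k ∈ Finset.range N, (k : ℝ)) atTop atTop := by
    have hsq : Tendsto (fun N : ℕ => (N : ℝ) ^ 2) atTop atTop :=
      (tendsto_pow_atTop two_ne_zero).comp tendsto_natCast_atTop_atTop
    refine (hid.pos_mul_atTop (by norm_num) hsq).congr' ?_
    filter_upwards [eventually_gt_atTop 0] with N hN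
    exact div_mul_cancel₀ _ (by positivity)
  have hs := (hlo.sum_range (fun _ => Nat.cast_nonneg _) hdiv).tendsto_div_nhds_zero
  have hmain := hc.sub ((hs.mul hid).add (hid.const_mul c))
  have hval : c - (0 * (1 / 2) + c * (1 / 2)) = c / 2 := by ring
  rw [hval] at hmain
  refine hmain.congr' ?_
  filter_upwards [eventually_gt_atTop 1] with N hN
  rw [sum_attribute_eq hE, Finset.sum_sub_distrib, ← Finset.mul_sum]
  have h0 : (N : ℝ) ≠ 0 := by positivity
  have h1 : (∑ k ∈ Finset.range N, (k : ℝ)) ≠ 0 := by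
    refine (lt_of_lt_of_le one_pos ?_).ne'
    have := Finset.single_le_sum (f := fun k : ℕ => (k : ℝ)) (fun _ _ => Nat.cast_nonneg _)
      (Finset.mem_range.2 hN)
    simpa using this
  field_simp
  ring

/-- A counting function of positive attributes with linear growth is bounded by a multiple of
the identity. -/
theorem exists_card_le_mul (hE : ∀ N i, i ∈ E N ↔ p i ∧ ν i ≤ N) (hν : ∀ i, 0 < ν i) {c : ℝ}
    (hc : Tendsto (fun N : ℕ => ((E N).card : ℝ) / N) atTop (𝓝 c)) :
    ∃ M : ℝ, ∀ N, ((E N).card : ℝ) ≤ M * N := by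
  obtain ⟨M, hM⟩ := hc.bddAbove_range
  refine ⟨M, fun N => ?_⟩
  rcases Nat.eq_zero_or_pos N with rfl | hN
  · have : E 0 = ∅ := by
      refine Finset.eq_empty_of_forall_notMem fun i hi => ?_
      exact absurd ((hE 0 i).1 hi).2 (hν i).not_ge
    simp [this]
  · exact (div_le_iff₀ (by positivity)).1 (hM ⟨N, rfl⟩)

theorem sum_attribute_le (hE : ∀ N i, i ∈ E N ↔ p i ∧ ν i ≤ N) {M : ℝ}
    (hM : ∀ N, ((E N).card : ℝ) ≤ M * N) (N : ℕ) :
    ∑ i ∈ E N, (ν i : ℝ) ≤ M * (N : ℝ) ^ 2 := by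
  calc ∑ i ∈ E N, (ν i : ℝ) ≤ ∑ i ∈ E N, (N : ℝ) :=
        Finset.sum_le_sum fun i hi => Nat.cast_le.2 ((hE N i).1 hi).2
    _ = (E N).card * N := by rw [Finset.sum_const, nsmul_eq_mul]
    _ ≤ M * N * N := by gcongr; exact hM N
    _ = M * (N : ℝ) ^ 2 := by ring

/-- The conclusion is the convergence of `∑ ν⁻²` for attributes with at most linear growth. -/
theorem summable_inv_sq_of_card_le (hE : ∀ N i, i ∈ E N ↔ ν i ≤ N) (hν : ∀ i, 0 < ν i) {M : ℝ}
    (hM : ∀ N, ((E N).card : ℝ) ≤ M * N) :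
    Summable fun i => (((ν i : ℝ) ^ 2)⁻¹) := by
  classical
  have hs2 : Summable fun k : ℕ => (((k : ℝ) ^ 2)⁻¹) := by
    simp
  have hM0 : 0 ≤ M := by simpa using (Nat.cast_nonneg _).trans (hM 1)
  refine summable_of_sum_le (c := 8 * (M * ∑' k : ℕ, (((k : ℝ) ^ 2)⁻¹)))
    (fun i => by positivity) fun T => ?_
  -- Each `ν⁻²` is spread over the integers `k ∈ [ν, 2ν)`, where `ν⁻³ ≤ 8 k⁻³`.
  have h1 : ∀ i ∈ T, (((ν i : ℝ) ^ 2)⁻¹) ≤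
      8 * ∑ k ∈ Finset.range (2 * T.sup ν), if ν i ≤ k then (((k : ℝ) ^ 3)⁻¹) else 0 := by
    intro i hi
    have hpos : (0 : ℝ) < ν i := Nat.cast_pos.2 (hν i)
    have hsub : Finset.Ico (ν i) (2 * ν i) ⊆
        (Finset.range (2 * T.sup ν)).filter (fun k => ν i ≤ k) := by
      intro k hk
      rw [Finset.mem_Ico] at hk
      have := Finset.le_sup (f := ν) hi
      rw [Finset.mem_filter, Finset.mem_range]
      omega
    rw [← Finset.sum_filter]
    calc (((ν i : ℝ) ^ 2)⁻¹) = 8 * ∑ k ∈ Finset.Ico (ν i) (2 * ν i), (((2 * ν i : ℝ) ^ 3)⁻¹) := by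
          rw [Finset.sum_const, Nat.card_Ico, nsmul_eq_mul,
            show 2 * ν i - ν i = ν i by omega]
          field_simp
          norm_num
      _ ≤ 8 * ∑ k ∈ Finset.Ico (ν i) (2 * ν i), (((k : ℝ) ^ 3)⁻¹) := by
          gcongr with k hk
          · have := (Finset.mem_Ico.1 hk).1
            have := hν i
            have : 0 < k := by omega
            positivity
          · exact_mod_cast (Finset.mem_Ico.1 hk).2.le
      _ ≤ _ := by
          gcongr
  calc ∑ i ∈ T, (((ν i : ℝ) ^ 2)⁻¹)
      ≤ ∑ i ∈ T, 8 * ∑ k ∈ Finset.range (2 * T.sup ν),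
          (if ν i ≤ k then (((k : ℝ) ^ 3)⁻¹) else 0) := Finset.sum_le_sum h1
    _ = 8 * ∑ k ∈ Finset.range (2 * T.sup ν), ∑ i ∈ T,
          (if ν i ≤ k then (((k : ℝ) ^ 3)⁻¹) else 0) := by
        rw [← Finset.mul_sum, Finset.sum_comm]
    _ ≤ 8 * ∑ k ∈ Finset.range (2 * T.sup ν), M * (((k : ℝ) ^ 2)⁻¹) := by
        gcongr with k hk
        rw [← Finset.sum_filter, Finset.sum_const, nsmul_eq_mul]
        have hcard : (((T.filter fun i => ν i ≤ k).card : ℕ) : ℝ) ≤ M * k := by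
          refine le_trans (Nat.cast_le.2 (Finset.card_le_card fun i hi => ?_)) (hM k)
          exact (hE k i).2 (Finset.mem_filter.1 hi).2
        rcases Nat.eq_zero_or_pos k with rfl | hk0
        · simp
        · calc _ ≤ M * k * (((k : ℝ) ^ 3)⁻¹) := by gcongr
            _ = M * (((k : ℝ) ^ 2)⁻¹) := by field_simp
    _ ≤ 8 * (M * ∑' k : ℕ, (((k : ℝ) ^ 2)⁻¹)) := by
        rw [← Finset.mul_sum]
        gcongr
        exact hs2.sum_le_tsum _ fun _ _ => by positivity

end Counting

open IsDedekindDomain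

/-! ### Möbius inversion over sets of primes -/

namespace NumberFieldFractions

variable {K : Type*} [Field K]

section PrimeProducts

/-- The product of a finite set of nonzero primes. -/
noncomputable def primeProd (s : Finset (HeightOneSpectrum (𝓞 K))) : (Ideal (𝓞 K))⁰ :=
  ∏ v ∈ s, ⟨v.asIdeal, mem_nonZeroDivisors_of_ne_zero v.ne_bot⟩

theorem coe_primeProd (s : Finset (HeightOneSpectrum (𝓞 K))) :
    (primeProd s : Ideal (𝓞 K)) = ∏ v ∈ s, v.asIdeal := by
  simp [primeProd]

variable [NumberField K]

theorem primeProd_dvd_iff (s : Finset (HeightOneSpectrum (𝓞 K))) (I : Ideal (𝓞 K)) :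
    (primeProd s : Ideal (𝓞 K)) ∣ I ↔ ∀ v ∈ s, v.asIdeal ∣ I := by
  rw [coe_primeProd]
  refine ⟨fun h v hv => (Finset.dvd_prod_of_mem _ hv).trans h,
    Finset.prod_dvd_of_coprime fun v _ w _ hvw => ?_⟩
  have := v.isMaximal
  have := w.isMaximal
  exact Ideal.isCoprime_of_isMaximal fun h => hvw (HeightOneSpectrum.ext h)

theorem absNorm_primeProd (s : Finset (HeightOneSpectrum (𝓞 K))) :
    Ideal.absNorm (primeProd s : Ideal (𝓞 K)) = ∏ v ∈ s, Ideal.absNorm v.asIdeal := by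
  rw [coe_primeProd, map_prod]

theorem one_lt_absNorm_asIdeal (v : HeightOneSpectrum (𝓞 K)) : 1 < Ideal.absNorm v.asIdeal := by
  have h0 : Ideal.absNorm v.asIdeal ≠ 0 := fun h => v.ne_bot (Ideal.absNorm_eq_zero_iff.1 h)
  have h1 : Ideal.absNorm v.asIdeal ≠ 1 :=
    fun h => v.isPrime.ne_top (Ideal.absNorm_eq_one_iff.1 h)
  omega

theorem finite_absNorm_asIdeal_le (N : ℕ) :
    {v : HeightOneSpectrum (𝓞 K) | Ideal.absNorm v.asIdeal ≤ N}.Finite := by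
  refine Set.Finite.of_finite_image ((Ideal.finite_setOfPred_absNorm_le (S := 𝓞 K) N).subset ?_)
    (f := HeightOneSpectrum.asIdeal) fun v _ w _ h => HeightOneSpectrum.ext h
  rintro _ ⟨v, hv, rfl⟩
  exact hv

/-- The finite set of primes of norm at most `N`. -/
noncomputable def primesLE (K : Type*) [Field K] [NumberField K] (N : ℕ) :
    Finset (HeightOneSpectrum (𝓞 K)) :=
  (finite_absNorm_asIdeal_le N).toFinset

theorem mem_primesLE {N : ℕ} {v : HeightOneSpectrum (𝓞 K)} :
    v ∈ primesLE K N ↔ Ideal.absNorm v.asIdeal ≤ N := by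
  simp [primesLE]

open scoped Classical in
/-- Möbius inversion on ideals: the alternating sum over the squarefree divisors of `I` detects
whether `I = 1`. -/
theorem sum_primeProd_dvd {N : ℕ} {I : Ideal (𝓞 K)} (hI : I ≠ ⊥) (hN : Ideal.absNorm I ≤ N) :
    (∑ s ∈ (primesLE K N).powerset,
      if (primeProd s : Ideal (𝓞 K)) ∣ I then (-1 : ℤ) ^ s.card else 0) =
      if I = ⊤ then 1 else 0 := by
  classical
  rw [← Finset.sum_filter]
  have hpos : 0 < Ideal.absNorm I :=
    Nat.pos_of_ne_zero fun h => hI (Ideal.absNorm_eq_zero_iff.1 h)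
  have hfil : (primesLE K N).powerset.filter (fun s => (primeProd s : Ideal (𝓞 K)) ∣ I) =
      (Ideal.finite_factors hI).toFinset.powerset := by
    ext s
    simp only [Finset.mem_filter, Finset.mem_powerset, primeProd_dvd_iff]
    constructor
    · rintro ⟨_, h⟩ v hv
      simpa using h v hv
    · intro h
      have h' : ∀ v ∈ s, v.asIdeal ∣ I := fun v hv => by simpa using h hv
      refine ⟨fun v hv => mem_primesLE.2 ((Nat.le_of_dvd hpos ?_).trans hN), h'⟩
      exact map_dvd Ideal.absNorm (h' v hv)
  rw [hfil, Finset.sum_powerset_neg_one_pow_card]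
  congr 1
  rw [eq_iff_iff]
  constructor
  · intro h
    by_contra hne
    obtain ⟨M, hM, hle⟩ := Ideal.exists_le_maximal I hne
    have hMb : M ≠ ⊥ := fun h0 => hI (le_bot_iff.1 (h0 ▸ hle))
    have hmem : (⟨M, hM.isPrime, hMb⟩ : HeightOneSpectrum (𝓞 K)) ∈
        (Ideal.finite_factors hI).toFinset := by
      simpa using Ideal.dvd_iff_le.2 hle
    rw [h] at hmem
    exact absurd hmem (Finset.notMem_empty _)
  · rintro rfl
    refine Finset.eq_empty_of_forall_notMem fun v hv => v.isPrime.ne_top ?_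
    have : v.asIdeal ∣ ⊤ := by simpa using hv
    exact top_le_iff.1 (Ideal.dvd_iff_le.1 this)

open scoped Classical in
/-- Möbius inversion, relative to an ideal `J`. -/
theorem sum_mul_primeProd_dvd {N : ℕ} {I J : Ideal (𝓞 K)} (hI : I ≠ ⊥)
    (hN : Ideal.absNorm I ≤ N) :
    (∑ s ∈ (primesLE K N).powerset,
      if I ≤ J * (primeProd s : Ideal (𝓞 K)) then (-1 : ℤ) ^ s.card else 0) =
      if I = J then 1 else 0 := by
  by_cases hJ : J ∣ I
  · obtain ⟨L, rfl⟩ := hJ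
    have hJ0 : J ≠ 0 := left_ne_zero_of_mul hI
    have hL0 : L ≠ ⊥ := right_ne_zero_of_mul hI
    have hLN : Ideal.absNorm L ≤ N := by
      refine le_trans (Nat.le_of_dvd (Nat.pos_of_ne_zero ?_) ?_) hN
      · exact fun h => hI (Ideal.absNorm_eq_zero_iff.1 h)
      · rw [map_mul]; exact dvd_mul_left _ _
    simp only [← Ideal.dvd_iff_le, mul_dvd_mul_iff_left hJ0]
    rw [sum_primeProd_dvd hL0 hLN]
    congr 1
    rw [← Ideal.one_eq_top, eq_iff_iff, mul_eq_left₀ hJ0]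
  · rw [if_neg fun h => hJ h.symm.dvd]
    refine Finset.sum_eq_zero fun s _ => if_neg fun h => hJ ?_
    exact (dvd_mul_right _ _).trans (Ideal.dvd_iff_le.2 h)

end PrimeProducts

/-! ### Counting fractions with a given ideal -/

theorem Denominator.ideal_injective :
    Function.Injective (Denominator.ideal : Denominator K → Ideal (𝓞 K)) := fun _ _ h =>
  Subtype.ext ((Ideal.associatesEquivIsPrincipal (𝓞 K)).injective (Subtype.ext h))

theorem Denominator.ideal_isPrincipal (b : Denominator K) : b.ideal.IsPrincipal :=
  (Ideal.associatesEquivIsPrincipal (𝓞 K) b.1).2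

theorem Denominator.ideal_ne_bot (b : Denominator K) : b.ideal ≠ ⊥ := by
  obtain ⟨x, hx⟩ := Associates.mk_surjective b.1
  rw [Denominator.ideal_eq hx]
  intro h
  refine b.2 ?_
  rw [← hx, Ideal.span_singleton_eq_bot.1 h]
  exact Associates.mk_zero

theorem exists_denominator_ideal_eq {I : Ideal (𝓞 K)} (hI : I ≠ ⊥) (hp : I.IsPrincipal) :
    ∃ b : Denominator K, b.ideal = I := by
  obtain ⟨x, hx⟩ := hp
  have hx0 : x ≠ 0 := by
    rintro rfl
    exact hI (by simpa using hx)
  exact ⟨⟨Associates.mk x, Associates.mk_ne_zero.2 hx0⟩, (Denominator.ideal_mk x _).trans hx.symm⟩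

theorem FractionPair.ideal_le_gcdIdeal (y : FractionPair K) : y.1.ideal ≤ y.gcdIdeal := by
  intro x hx
  rw [FractionPair.gcdIdeal, Ideal.mem_comap, Ideal.Quotient.eq_zero_iff_mem.2 hx]
  exact zero_mem _

theorem FractionPair.gcdIdeal_le_iff {b : Denominator K} {a : 𝓞 K ⧸ b.ideal} {J : Ideal (𝓞 K)}
    (hJ : b.ideal ≤ J) :
    FractionPair.gcdIdeal (⟨b, a⟩ : FractionPair K) ≤ J ↔
      a ∈ J.map (Ideal.Quotient.mk b.ideal) := by
  have hcm : (J.map (Ideal.Quotient.mk b.ideal)).comap (Ideal.Quotient.mk b.ideal) = J := by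
    rw [Ideal.comap_map_of_surjective _ Ideal.Quotient.mk_surjective, ← RingHom.ker_eq_comap_bot,
      Ideal.mk_ker, sup_eq_left]
    exact hJ
  rw [FractionPair.gcdIdeal]
  constructor
  · intro h
    have h2 := Ideal.map_mono (f := Ideal.Quotient.mk b.ideal) h
    rw [Ideal.map_comap_of_surjective _ Ideal.Quotient.mk_surjective] at h2
    exact h2 (Ideal.mem_span_singleton_self a)
  · intro h
    conv_rhs => rw [← hcm]
    exact Ideal.comap_mono ((Ideal.span_singleton_le_iff_mem _).2 h)

variable [NumberField K]

instance (b : Denominator K) : Finite (𝓞 K ⧸ b.ideal) :=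
  Ideal.finiteQuotientOfFreeOfNeBot _ b.ideal_ne_bot

theorem Denominator.norm_pos (b : Denominator K) : 0 < b.norm :=
  Nat.pos_of_ne_zero fun h => b.ideal_ne_bot (Ideal.absNorm_eq_zero_iff.1 h)

theorem finite_denominator_norm_le (N : ℕ) : {b : Denominator K | b.norm ≤ N}.Finite := by
  refine Set.Finite.of_finite_image ((Ideal.finite_setOfPred_absNorm_le (S := 𝓞 K) N).subset ?_)
    (f := Denominator.ideal) Denominator.ideal_injective.injOn
  rintro _ ⟨b, hb, rfl⟩
  exact hb

/-- If `⟨b⟩ = J e`, then `N e` numerators modulo `b` lie in `J`. -/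
theorem card_gcdIdeal_le {b : Denominator K} {J e : Ideal (𝓞 K)} (h : b.ideal = J * e) :
    Nat.card {a : 𝓞 K ⧸ b.ideal // FractionPair.gcdIdeal (⟨b, a⟩ : FractionPair K) ≤ J} =
      Ideal.absNorm e := by
  have hle : b.ideal ≤ J := h ▸ Ideal.mul_le_left
  have hJ : J ≠ ⊥ := fun h0 => b.ideal_ne_bot (le_bot_iff.1 (h0 ▸ hle))
  have hJ0 : 0 < Ideal.absNorm J :=
    Nat.pos_of_ne_zero fun h0 => hJ (Ideal.absNorm_eq_zero_iff.1 h0)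
  have h1 := AddSubgroup.card_eq_card_quotient_mul_card_addSubgroup
    (J.map (Ideal.Quotient.mk b.ideal)).toAddSubgroup
  have h2 : Nat.card ((𝓞 K ⧸ b.ideal) ⧸ (J.map (Ideal.Quotient.mk b.ideal)).toAddSubgroup) =
      Ideal.absNorm J := by
    rw [Ideal.absNorm_apply, Submodule.cardQuot_apply]
    exact Nat.card_congr (DoubleQuot.quotQuotEquivQuotOfLE hle).toEquiv
  have h3 : Nat.card (𝓞 K ⧸ b.ideal) = Ideal.absNorm J * Ideal.absNorm e := by
    rw [← map_mul, ← h, Ideal.absNorm_apply, Submodule.cardQuot_apply]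
  rw [h2, h3] at h1
  rw [Nat.eq_of_mul_eq_mul_left hJ0 h1]
  exact Nat.card_congr (Equiv.subtypeEquivRight fun a => FractionPair.gcdIdeal_le_iff hle)

open scoped Classical in
/-- The ideals of norm at most `N` in the ideal class `C`. -/
noncomputable def idealsLE (C : ClassGroup (𝓞 K)) (N : ℕ) : Finset (Ideal (𝓞 K))⁰ :=
  (Ideal.finite_setOfPred_absNorm_le₀ (S := 𝓞 K) N).toFinset.filter
    fun I => ClassGroup.mk0 I = C

theorem mem_idealsLE {C : ClassGroup (𝓞 K)} {N : ℕ} {I : (Ideal (𝓞 K))⁰} :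
    I ∈ idealsLE C N ↔ ClassGroup.mk0 I = C ∧ Ideal.absNorm (I : Ideal (𝓞 K)) ≤ N := by
  simp [idealsLE, and_comm]

/-- The sum of the norms of the ideals of norm at most `N` in the class `C`. -/
noncomputable def normSum (C : ClassGroup (𝓞 K)) (N : ℕ) : ℕ :=
  ∑ I ∈ idealsLE C N, Ideal.absNorm (I : Ideal (𝓞 K))

theorem normSum_zero (C : ClassGroup (𝓞 K)) : normSum C 0 = 0 := by
  refine Finset.sum_eq_zero fun I hI => ?_
  exact Nat.le_zero.1 (mem_idealsLE.1 hI).2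

open scoped Classical in
/-- The finite set of all pairs whose denominator has norm at most `N`. -/
noncomputable def pairsLE (K : Type*) [Field K] [NumberField K] (N : ℕ) :
    Finset (FractionPair K) :=
  (finite_denominator_norm_le N).toFinset.sigma fun b =>
    (Set.finite_univ (α := 𝓞 K ⧸ b.ideal)).toFinset

theorem mem_pairsLE {N : ℕ} {y : FractionPair K} : y ∈ pairsLE K N ↔ y.kappa ≤ N := by
  simp [pairsLE, FractionPair.kappa]

theorem mk0_eq_inv_iff (J e : (Ideal (𝓞 K))⁰) :
    ClassGroup.mk0 e = (ClassGroup.mk0 J)⁻¹ ↔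
      ((J : Ideal (𝓞 K)) * (e : Ideal (𝓞 K))).IsPrincipal := by
  rw [eq_inv_iff_mul_eq_one, mul_comm, ← map_mul]
  exact ClassGroup.mk0_eq_one_iff (J * e).2

open scoped Classical in
/-- Writing `⟨b⟩ = J e` turns the fractions with `J ∣ ⟨a, b⟩` into ideals `e` in the class
inverse to that of `J`, each counted with weight `N e`. -/
theorem card_pairsLE_gcdIdeal_le (J : (Ideal (𝓞 K))⁰) (N : ℕ) :
    ((pairsLE K N).filter fun y => y.gcdIdeal ≤ (J : Ideal (𝓞 K))).card =
      normSum (ClassGroup.mk0 J)⁻¹ (N / Ideal.absNorm (J : Ideal (𝓞 K))) := by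
  have hJ0 := Ideal.absNorm_pos_of_nonZeroDivisors J
  rw [Finset.card_filter, pairsLE, Finset.sum_sigma, normSum]
  have hex : ∀ e : (Ideal (𝓞 K))⁰, ClassGroup.mk0 e = (ClassGroup.mk0 J)⁻¹ →
      ∃ b : Denominator K, b.ideal = J * e := fun e he =>
    exists_denominator_ideal_eq (nonZeroDivisors.coe_ne_zero (J * e))
      ((mk0_eq_inv_iff J e).1 he)
  have hterm : ∀ b : Denominator K,
      (∑ a ∈ (Set.finite_univ (α := 𝓞 K ⧸ b.ideal)).toFinset,
        if FractionPair.gcdIdeal (⟨b, a⟩ : FractionPair K) ≤ (J : Ideal (𝓞 K)) then 1 else 0) =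
      Nat.card {a : 𝓞 K ⧸ b.ideal //
        FractionPair.gcdIdeal (⟨b, a⟩ : FractionPair K) ≤ (J : Ideal (𝓞 K))} := by
    intro b
    rw [← Finset.card_filter]
    exact (Nat.subtype_card _ fun a => by simp).symm
  symm
  rw [← Finset.sum_filter_of_ne (p := fun b : Denominator K => b.ideal ≤ J)]
  · choose f hf using hex
    refine Finset.sum_bij (fun e he => f e (mem_idealsLE.1 he).1) ?_ ?_ ?_ ?_
    · intro e he
      have h1 := hf e (mem_idealsLE.1 he).1
      rw [Finset.mem_filter, Set.Finite.mem_toFinset, Set.mem_ofPred_eq, Denominator.norm, h1,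
        map_mul, mul_comm]
      exact ⟨(Nat.le_div_iff_mul_le hJ0).1 (mem_idealsLE.1 he).2, Ideal.mul_le_left⟩
    · intro e he e' he' h
      have h1 := hf e (mem_idealsLE.1 he).1
      rw [h, hf e' (mem_idealsLE.1 he').1] at h1
      exact Subtype.ext (mul_left_cancel₀ (nonZeroDivisors.coe_ne_zero J) h1).symm
    · intro b hb
      rw [Finset.mem_filter, Set.Finite.mem_toFinset, Set.mem_ofPred_eq] at hb
      obtain ⟨e, he⟩ := Ideal.dvd_iff_le.2 hb.2
      have he0 : e ≠ 0 := fun h0 => b.ideal_ne_bot (by rw [he, h0, mul_zero]; rfl)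
      have hmk : ClassGroup.mk0 (⟨e, mem_nonZeroDivisors_of_ne_zero he0⟩ : (Ideal (𝓞 K))⁰) =
          (ClassGroup.mk0 J)⁻¹ := by
        rw [mk0_eq_inv_iff]
        exact he ▸ b.ideal_isPrincipal
      refine ⟨⟨e, mem_nonZeroDivisors_of_ne_zero he0⟩, mem_idealsLE.2 ⟨hmk, ?_⟩, ?_⟩
      · rw [Nat.le_div_iff_mul_le hJ0, mul_comm, ← map_mul, ← he]
        exact hb.1
      · exact Denominator.ideal_injective ((hf _ hmk).trans he.symm)
    · intro e he
      rw [hterm]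
      exact (card_gcdIdeal_le (hf e (mem_idealsLE.1 he).1)).symm
  · intro b _ hb
    obtain ⟨a, _, ha⟩ := Finset.exists_ne_zero_of_sum_ne_zero hb
    by_contra hle
    exact ha (if_neg fun h =>
      hle ((FractionPair.ideal_le_gcdIdeal (⟨b, a⟩ : FractionPair K)).trans h))

open scoped Classical in
/-- The number of fractions `a / b` with `⟨a, b⟩ = J`, by Möbius inversion. -/
theorem card_pairsLE_gcdIdeal_eq (J : (Ideal (𝓞 K))⁰) (N : ℕ) :
    (((pairsLE K N).filter fun y => y.gcdIdeal = (J : Ideal (𝓞 K))).card : ℤ) =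
      ∑ s ∈ (primesLE K N).powerset, (-1) ^ s.card *
        (normSum (ClassGroup.mk0 (J * primeProd s))⁻¹
          (N / Ideal.absNorm ((J * primeProd s : (Ideal (𝓞 K))⁰) : Ideal (𝓞 K))) : ℤ) := by
  rw [Finset.card_filter, Nat.cast_sum]
  have h1 : ∀ y ∈ pairsLE K N,
      (((if y.gcdIdeal = (J : Ideal (𝓞 K)) then 1 else 0 : ℕ) : ℤ)) =
      ∑ s ∈ (primesLE K N).powerset,
        if y.gcdIdeal ≤ (J : Ideal (𝓞 K)) * (primeProd s : Ideal (𝓞 K)) then (-1 : ℤ) ^ s.card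
        else 0 := by
    intro y hy
    have hle := y.ideal_le_gcdIdeal
    have h0 : y.gcdIdeal ≠ ⊥ := fun h => y.1.ideal_ne_bot (le_bot_iff.1 (h ▸ hle))
    have hN : Ideal.absNorm y.gcdIdeal ≤ N :=
      (Nat.le_of_dvd y.1.norm_pos (Ideal.absNorm_dvd_absNorm_of_le hle)).trans (mem_pairsLE.1 hy)
    rw [sum_mul_primeProd_dvd h0 hN]
    push_cast
    rfl
  rw [Finset.sum_congr rfl h1, Finset.sum_comm]
  refine Finset.sum_congr rfl fun s _ => ?_
  rw [← card_pairsLE_gcdIdeal_le, ← Finset.sum_filter, Finset.sum_const, nsmul_eq_mul, mul_comm]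
  rfl

end NumberFieldFractions

/-! ### Asymptotics of the counting functions -/

namespace NumberFieldFractions

section Asymptotics

variable (K : Type*) [Field K] [NumberField K]

/-- The asymptotic density `c` of the ideals in an ideal class does not depend on the class. -/
theorem exists_tendsto_card_idealsLE_div :
    ∃ c : ℝ, 0 < c ∧ ∀ C : ClassGroup (𝓞 K),
      Tendsto (fun N : ℕ => ((idealsLE C N).card : ℝ) / N) atTop (𝓝 c) := by
  refine ⟨_, ?_, fun C => ((Ideal.tendsto_norm_le_and_mk_eq_div_atTop K C).comp
    tendsto_natCast_atTop_atTop).congr fun N => ?_⟩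
  · have h1 := Units.regulator_pos K
    have h2 : 0 < |(discr K : ℝ)| := abs_pos.2 (Int.cast_ne_zero.2 (discr_ne_zero K))
    have h3 := Units.torsionOrder_pos K
    positivity
  · simp only [Function.comp_apply, Nat.cast_le]
    congr 2
    exact Nat.subtype_card _ fun I => by rw [mem_idealsLE, and_comm]

theorem exists_tendsto_normSum_div_sq :
    ∃ c : ℝ, 0 < c ∧ ∀ C : ClassGroup (𝓞 K),
      Tendsto (fun N : ℕ => (normSum C N : ℝ) / (N : ℝ) ^ 2) atTop (𝓝 c) := by
  obtain ⟨c, hc, h⟩ := exists_tendsto_card_idealsLE_div K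
  refine ⟨c / 2, half_pos hc, fun C => ?_⟩
  have := tendsto_sum_attribute_div_sq (fun N I => mem_idealsLE (C := C) (N := N) (I := I)) (h C)
  simpa only [normSum, Nat.cast_sum] using this

theorem exists_normSum_le :
    ∃ M : ℝ, 0 ≤ M ∧ ∀ (C : ClassGroup (𝓞 K)) (N : ℕ), (normSum C N : ℝ) ≤ M * (N : ℝ) ^ 2 := by
  obtain ⟨c, -, h⟩ := exists_tendsto_card_idealsLE_div K
  have hex : ∀ C : ClassGroup (𝓞 K), ∃ M : ℝ, ∀ N, ((idealsLE C N).card : ℝ) ≤ M * N := fun C =>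
    exists_card_le_mul (fun N I => mem_idealsLE (C := C) (N := N) (I := I))
      Ideal.absNorm_pos_of_nonZeroDivisors (h C)
  choose M hM using hex
  refine ⟨∑ C, |M C|, Finset.sum_nonneg fun _ _ => abs_nonneg _, fun C N => ?_⟩
  have h1 := sum_attribute_le (fun N I => mem_idealsLE (C := C) (N := N) (I := I)) (hM C) N
  rw [normSum, Nat.cast_sum]
  refine h1.trans ?_
  gcongr
  exact (le_abs_self _).trans
    (Finset.single_le_sum (f := fun C => |M C|) (fun _ _ => abs_nonneg _) (Finset.mem_univ C))

theorem summable_inv_sq_absNorm_asIdeal :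
    Summable fun v : HeightOneSpectrum (𝓞 K) => (((Ideal.absNorm v.asIdeal : ℝ) ^ 2)⁻¹) := by
  have hs : Summable fun I : (Ideal (𝓞 K))⁰ =>
      (((Ideal.absNorm (I : Ideal (𝓞 K)) : ℝ) ^ 2)⁻¹) := by
    have hlim := (Ideal.tendsto_norm_le_div_atTop₀ K).comp
      (tendsto_natCast_atTop_atTop (R := ℝ))
    have hE : ∀ (N : ℕ) (I : (Ideal (𝓞 K))⁰),
        I ∈ (Ideal.finite_setOfPred_absNorm_le₀ (S := 𝓞 K) N).toFinset ↔
          True ∧ Ideal.absNorm (I : Ideal (𝓞 K)) ≤ N := fun N I => by simp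
    obtain ⟨M, hM⟩ := exists_card_le_mul hE Ideal.absNorm_pos_of_nonZeroDivisors
      (hlim.congr fun N => by
        simp only [Function.comp_apply, Nat.cast_le]
        congr 2
        exact Nat.subtype_card _ fun I => by simp)
    exact summable_inv_sq_of_card_le (fun N I => (hE N I).trans (iff_of_eq (true_and _)))
      Ideal.absNorm_pos_of_nonZeroDivisors hM
  exact hs.comp_injective
    (i := fun v : HeightOneSpectrum (𝓞 K) =>
      (⟨v.asIdeal, mem_nonZeroDivisors_of_ne_zero v.ne_bot⟩ : (Ideal (𝓞 K))⁰))
    fun v w h => HeightOneSpectrum.ext (congrArg Subtype.val h)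

/-- The Euler product `∏ (1 - N v⁻²)` does not vanish. -/
theorem tsum_prod_neg_absNorm_ne_zero :
    (∑' s : Finset (HeightOneSpectrum (𝓞 K)),
      ∏ v ∈ s, (-((Ideal.absNorm v.asIdeal : ℝ) ^ 2)⁻¹)) ≠ 0 := by
  have hs : Summable fun v : HeightOneSpectrum (𝓞 K) =>
      ‖(-((Ideal.absNorm v.asIdeal : ℝ) ^ 2)⁻¹)‖ :=
    (summable_inv_sq_absNorm_asIdeal K).neg.norm
  rw [← tprod_one_add (summable_finsetProd_of_summable_norm hs)]
  refine tprod_one_add_ne_zero_of_summable (fun v => ?_) hs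
  have h1 : (1 : ℝ) < (Ideal.absNorm v.asIdeal : ℝ) ^ 2 :=
    one_lt_pow₀ (Nat.one_lt_cast.2 (one_lt_absNorm_asIdeal v)) two_ne_zero
  have := inv_lt_one_of_one_lt₀ h1
  linarith

variable {K}

theorem tendsto_normSum_div_div_sq {C : ClassGroup (𝓞 K)} {c : ℝ}
    (h : Tendsto (fun N : ℕ => (normSum C N : ℝ) / (N : ℝ) ^ 2) atTop (𝓝 c)) {k : ℕ}
    (hk : 0 < k) :
    Tendsto (fun N : ℕ => (normSum C (N / k) : ℝ) / (N : ℝ) ^ 2) atTop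
      (𝓝 (c * ((k : ℝ) ^ 2)⁻¹)) := by
  have h1 : Tendsto (fun N : ℕ => ((N / k : ℕ) : ℝ) / N) atTop (𝓝 ((k : ℝ)⁻¹)) := by
    refine ((tendsto_nat_floor_mul_div_atTop (R := ℝ) (a := (k : ℝ)⁻¹) (by positivity)).comp
      tendsto_natCast_atTop_atTop).congr fun N => ?_
    rw [Function.comp_apply, mul_comm, ← div_eq_mul_inv, Nat.floor_div_natCast, Nat.floor_natCast]
  have h2 := (h.comp (Nat.tendsto_div_const_atTop hk.ne')).mul (h1.pow 2)
  rw [inv_pow] at h2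
  refine h2.congr' ?_
  filter_upwards [eventually_ge_atTop k] with N hN
  have h3 : ((N / k : ℕ) : ℝ) ≠ 0 := Nat.cast_ne_zero.2 (Nat.div_pos hN hk).ne'
  simp only [Function.comp_apply]
  field_simp

variable (K)

open scoped Classical in
/-- The number of fractions with `⟨a, b⟩ = J` and denominator of norm at most `N` is asymptotic to
`L (N / N J)²`, with the same constant `L` for all `J`. -/
theorem exists_tendsto_card_gcdIdeal_eq :
    ∃ L : ℝ, L ≠ 0 ∧ ∀ J : (Ideal (𝓞 K))⁰,
      Tendsto (fun N : ℕ =>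
        (((pairsLE K N).filter fun y => y.gcdIdeal = (J : Ideal (𝓞 K))).card : ℝ) / (N : ℝ) ^ 2)
        atTop (𝓝 (L * ((Ideal.absNorm (J : Ideal (𝓞 K)) : ℝ) ^ 2)⁻¹)) := by
  obtain ⟨c, hc, hlim⟩ := exists_tendsto_normSum_div_sq K
  obtain ⟨M, hM0, hM⟩ := exists_normSum_le K
  refine ⟨c * ∑' s : Finset (HeightOneSpectrum (𝓞 K)),
      ∏ v ∈ s, (-((Ideal.absNorm v.asIdeal : ℝ) ^ 2)⁻¹),
    mul_ne_zero hc.ne' (tsum_prod_neg_absNorm_ne_zero K), fun J => ?_⟩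
  obtain ⟨q, hq⟩ : ∃ q : Finset (HeightOneSpectrum (𝓞 K)) → ℕ, ∀ s,
      q s = Ideal.absNorm ((J * primeProd s : (Ideal (𝓞 K))⁰) : Ideal (𝓞 K)) := ⟨_, fun _ => rfl⟩
  have hqpos : ∀ s, 0 < q s := fun s => hq s ▸ Ideal.absNorm_pos_of_nonZeroDivisors _
  have hqeq : ∀ s, q s = Ideal.absNorm (J : Ideal (𝓞 K)) *
      ∏ v ∈ s, Ideal.absNorm v.asIdeal := fun s => by
    rw [hq, ← absNorm_primeProd, ← map_mul, Submonoid.coe_mul]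
  have hJ1 : 1 ≤ Ideal.absNorm (J : Ideal (𝓞 K)) := Ideal.absNorm_pos_of_nonZeroDivisors J
  have hv0 : ∀ v : HeightOneSpectrum (𝓞 K), 0 < Ideal.absNorm v.asIdeal := fun v =>
    zero_lt_one.trans (one_lt_absNorm_asIdeal v)
  have hbound : Summable fun s : Finset (HeightOneSpectrum (𝓞 K)) =>
      M * ∏ v ∈ s, (((Ideal.absNorm v.asIdeal : ℝ) ^ 2)⁻¹) :=
    (summable_finsetProd_of_summable_nonneg (fun v => by positivity)
      (summable_inv_sq_absNorm_asIdeal K)).mul_left M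
  -- The domination needed for the interchange of limit and sum is uniform in the ideal class.
  have hdom : ∀ᶠ N : ℕ in atTop, ∀ s : Finset (HeightOneSpectrum (𝓞 K)),
      ‖(-1 : ℝ) ^ s.card *
        ((normSum (ClassGroup.mk0 (J * primeProd s))⁻¹ (N / q s) : ℝ) / (N : ℝ) ^ 2)‖ ≤
      M * ∏ v ∈ s, (((Ideal.absNorm v.asIdeal : ℝ) ^ 2)⁻¹) := by
    filter_upwards [eventually_gt_atTop 0] with N hN s
    have hP : 0 < ∏ v ∈ s, Ideal.absNorm v.asIdeal := Finset.prod_pos fun v _ => hv0 v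
    have hle : ((N / q s : ℕ) : ℝ) ≤ N * ((∏ v ∈ s, Ideal.absNorm v.asIdeal : ℕ) : ℝ)⁻¹ := by
      refine Nat.cast_div_le.trans ?_
      rw [← div_eq_mul_inv]
      refine div_le_div_of_nonneg_left (Nat.cast_nonneg _) (Nat.cast_pos.2 hP) (Nat.cast_le.2 ?_)
      rw [hqeq]
      exact Nat.le_mul_of_pos_left _ hJ1
    have hprod : ∏ v ∈ s, (((Ideal.absNorm v.asIdeal : ℝ) ^ 2)⁻¹) =
        (((∏ v ∈ s, Ideal.absNorm v.asIdeal : ℕ) : ℝ)⁻¹) ^ 2 := by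
      rw [Finset.prod_inv_distrib, Finset.prod_pow, Nat.cast_prod, inv_pow]
    rw [norm_mul, norm_pow, norm_neg, norm_one, one_pow, one_mul,
      Real.norm_of_nonneg (by positivity), div_le_iff₀ (by positivity), hprod, mul_assoc,
      ← mul_pow, mul_comm _ (N : ℝ)]
    exact (hM _ _).trans
      (mul_le_mul_of_nonneg_left (pow_le_pow_left₀ (Nat.cast_nonneg _) hle 2) hM0)
  have hmain := tendsto_tsum_of_dominated_convergence hbound
    (fun s => (tendsto_normSum_div_div_sq (hlim (ClassGroup.mk0 (J * primeProd s))⁻¹)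
      (hqpos s)).const_mul ((-1 : ℝ) ^ s.card)) hdom
  have hval : (∑' s : Finset (HeightOneSpectrum (𝓞 K)),
      (-1 : ℝ) ^ s.card * (c * ((q s : ℝ) ^ 2)⁻¹)) =
      (c * ∑' s : Finset (HeightOneSpectrum (𝓞 K)),
        ∏ v ∈ s, (-((Ideal.absNorm v.asIdeal : ℝ) ^ 2)⁻¹)) *
        ((Ideal.absNorm (J : Ideal (𝓞 K)) : ℝ) ^ 2)⁻¹ := by
    rw [mul_right_comm, ← tsum_mul_left]
    refine tsum_congr fun s => ?_
    rw [hqeq, Finset.prod_neg, Finset.prod_inv_distrib, Finset.prod_pow]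
    push_cast
    rw [mul_pow, mul_inv]
    ring
  rw [hval] at hmain
  refine hmain.congr fun N => ?_
  -- The terms with a prime of norm greater than `N` vanish.
  rw [tsum_eq_sum (s := (primesLE K N).powerset)]
  · have h := congrArg (Int.cast : ℤ → ℝ) (card_pairsLE_gcdIdeal_eq J N)
    push_cast at h
    rw [h, Finset.sum_div]
    refine Finset.sum_congr rfl fun s _ => ?_
    rw [mul_div_assoc, hq, Submonoid.coe_mul]
  · intro s hs
    obtain ⟨v, hvs, hv⟩ : ∃ v ∈ s, v ∉ primesLE K N := by
      simpa [Finset.subset_iff] using hs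
    have h1 : N < q s := by
      rw [mem_primesLE, not_le] at hv
      refine hv.trans_le (Nat.le_of_dvd (hqpos s) ?_)
      rw [hqeq]
      exact (Finset.dvd_prod_of_mem _ hvs).mul_left _
    rw [Nat.div_eq_of_lt h1, normSum_zero]
    simp

end Asymptotics

end NumberFieldFractions

/-! ### Densities with respect to a system of representatives -/

namespace NumberFieldFractions

variable {K : Type*} [Field K]

theorem FractionPair.exists_represents (y : FractionPair K) : ∃ a b : 𝓞 K, y.Represents a b := by
  obtain ⟨b, hb⟩ := Associates.mk_surjective y.1.1
  obtain ⟨a, ha⟩ := Ideal.Quotient.mk_surjective y.2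
  exact ⟨a, b, hb, ha⟩

theorem eq_one_of_isPrincipal {ℛ : Set (Ideal (𝓞 K))⁰}
    (hins : ∀ 𝔤 ∈ ℛ, IsInseverable (𝔤 : Ideal (𝓞 K))) {𝔤 : (Ideal (𝓞 K))⁰}
     (h : 𝔤 ∈ ℛ) (hp : (𝔤 : Ideal (𝓞 K)).IsPrincipal) : 𝔤 = 1 :=
  Subtype.ext ((hins 𝔤 h _ hp dvd_rfl).trans Ideal.one_eq_top.symm)

variable [NumberField K]

/-- A fraction with inseverable ideal `⟨a, b⟩` is automatically reduced. -/
theorem mem_reducedFractions_of_isInseverable {y : FractionPair K}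
    (h : IsInseverable y.gcdIdeal) : y ∈ reducedFractions K := by
  obtain ⟨a, b, hab⟩ := y.exists_represents
  refine ⟨a, b, hab, fun h0 => y.1.2 ?_, fun c hca hcb => ?_⟩
  · rw [← hab.1, h0]; exact Associates.mk_zero
  · rw [← Ideal.span_singleton_eq_top]
    refine h _ ⟨c, rfl⟩ (Ideal.dvd_iff_le.2 ?_)
    rw [hab.gcdIdeal_eq, Ideal.span_le, Set.insert_subset_iff, Set.singleton_subset_iff]
    exact ⟨Ideal.mem_span_singleton.2 hca, Ideal.mem_span_singleton.2 hcb⟩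

open scoped Classical in
/-- The pairs are counted from attribute `1` on, which loses nothing as norms of denominators are
positive. -/
theorem sum_attributeCount_eq_card (A : Set (FractionPair K)) (N : ℕ) :
    ∑ n ∈ Finset.Icc 1 N, attributeCount FractionPair.kappa A n =
      ((pairsLE K N).filter fun y => y ∈ A).card := by
  rw [Finset.card_eq_sum_card_fiberwise (f := FractionPair.kappa) (t := Finset.Icc 1 N)]
  · refine Finset.sum_congr rfl fun n hn => ?_
    rw [attributeCount, ← Set.ncard_coe_finset]
    congr 1
    ext y
    have := (Finset.mem_Icc.1 hn).2
    simp only [Finset.coe_filter, Finset.mem_filter, mem_pairsLE]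
    constructor
    · rintro ⟨h1, h2⟩
      exact ⟨⟨h2.trans_le this, h1⟩, h2⟩
    · rintro ⟨⟨-, h1⟩, h2⟩
      exact ⟨h1, h2⟩
  · intro y hy
    rw [Finset.mem_coe, Finset.mem_filter, mem_pairsLE] at hy
    exact Finset.mem_coe.2 (Finset.mem_Icc.2 ⟨y.1.norm_pos, hy.1⟩)

section Representatives

variable {ℛ : Set (Ideal (𝓞 K))⁰}

theorem IsRepresentativeSystem.finite (hℛ : IsRepresentativeSystem ℛ) : ℛ.Finite :=
  Set.Finite.of_finite_image (Set.toFinite _) hℛ.injOn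

theorem IsRepresentativeSystem.card_toFinset (hℛ : IsRepresentativeSystem ℛ) :
    hℛ.finite.toFinset.card = classNumber K := by
  rw [← Set.ncard_eq_toFinset_card ℛ hℛ.finite, ← hℛ.injOn.ncard_image, hℛ.image_eq,
    Set.ncard_univ, Nat.card_eq_fintype_card, classNumber]

theorem IsRepresentativeSystem.one_mem (hℛ : IsRepresentativeSystem ℛ)
    (hins : ∀ 𝔤 ∈ ℛ, IsInseverable (𝔤 : Ideal (𝓞 K))) : (1 : (Ideal (𝓞 K))⁰) ∈ ℛ := by
  obtain ⟨𝔤, h𝔤, h1⟩ := hℛ.surjOn (Set.mem_univ 1)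
  have := eq_one_of_isPrincipal hins h𝔤 ((ClassGroup.mk0_eq_one_iff 𝔤.2).1 h1)
  exact this ▸ h𝔤

/-- The density is `1 / ∑ N 𝔤⁻²`, where `𝔤` runs through the representatives. -/
theorem hasNaturalDensity_coprimeFractions (hℛ : IsRepresentativeSystem ℛ)
    (hins : ∀ 𝔤 ∈ ℛ, IsInseverable (𝔤 : Ideal (𝓞 K))) :
    HasNaturalDensity FractionPair.kappa (reducedFractionsWrt ℛ) (coprimeFractions K)
      (1 / ∑ 𝔤 ∈ hℛ.finite.toFinset, (((Ideal.absNorm (𝔤 : Ideal (𝓞 K)) : ℝ) ^ 2)⁻¹)) := by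
  classical
  obtain ⟨L, hL, hlim⟩ := exists_tendsto_card_gcdIdeal_eq K
  have h1mem : (1 : (Ideal (𝓞 K))⁰) ∈ hℛ.finite.toFinset :=
    hℛ.finite.mem_toFinset.2 (hℛ.one_mem hins)
  have hred : ∀ {y : FractionPair K} {𝔤 : (Ideal (𝓞 K))⁰}, 𝔤 ∈ ℛ →
      y.gcdIdeal = (𝔤 : Ideal (𝓞 K)) → y ∈ reducedFractions K := fun h𝔤 h =>
    mem_reducedFractions_of_isInseverable (h ▸ hins _ h𝔤)
  have hcop : ∀ N : ℕ, (∑ n ∈ Finset.Icc 1 N,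
      (attributeCount FractionPair.kappa (coprimeFractions K) n : ℝ)) =
      (((pairsLE K N).filter fun y =>
        y.gcdIdeal = ((1 : (Ideal (𝓞 K))⁰) : Ideal (𝓞 K))).card : ℝ) := by
    intro N
    rw [← Nat.cast_sum, sum_attributeCount_eq_card]
    congr 2
    refine Finset.filter_congr fun y _ => ?_
    exact ⟨fun h => h.2.trans Ideal.one_eq_top.symm,
      fun h => ⟨hred (hℛ.one_mem hins) h, h.trans Ideal.one_eq_top⟩⟩
  have hwrt : ∀ N : ℕ, (∑ n ∈ Finset.Icc 1 N,
      (attributeCount FractionPair.kappa (reducedFractionsWrt ℛ) n : ℝ)) =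
      ∑ 𝔤 ∈ hℛ.finite.toFinset,
        (((pairsLE K N).filter fun y => y.gcdIdeal = (𝔤 : Ideal (𝓞 K))).card : ℝ) := by
    intro N
    rw [← Nat.cast_sum, sum_attributeCount_eq_card, ← Nat.cast_sum, ← Finset.card_biUnion]
    · congr 2
      ext y
      simp only [Finset.mem_filter, Finset.mem_biUnion, Set.Finite.mem_toFinset]
      constructor
      · rintro ⟨hy, -, 𝔤, h𝔤, h⟩
        exact ⟨𝔤, h𝔤, hy, h⟩
      · rintro ⟨𝔤, h𝔤, hy, h⟩
        exact ⟨hy, hred h𝔤 h, 𝔤, h𝔤, h⟩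
    · intro 𝔤 _ 𝔥 _ hne
      refine Finset.disjoint_left.2 fun y hy hy' => hne (Subtype.ext ?_)
      exact (Finset.mem_filter.1 hy).2.symm.trans (Finset.mem_filter.1 hy').2
  have hpos : 0 < ∑ 𝔤 ∈ hℛ.finite.toFinset,
      (((Ideal.absNorm (𝔤 : Ideal (𝓞 K)) : ℝ) ^ 2)⁻¹) := by
    refine Finset.sum_pos (fun 𝔤 _ => ?_) ⟨1, h1mem⟩
    have := Ideal.absNorm_pos_of_nonZeroDivisors 𝔤
    positivity
  have hT := (hlim 1).div (tendsto_finsetSum hℛ.finite.toFinset fun 𝔤 _ => hlim 𝔤)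
    (by rw [← Finset.mul_sum]; exact mul_ne_zero hL hpos.ne')
  have hval : L * ((Ideal.absNorm ((1 : (Ideal (𝓞 K))⁰) : Ideal (𝓞 K)) : ℝ) ^ 2)⁻¹ /
      (∑ 𝔤 ∈ hℛ.finite.toFinset, L * ((Ideal.absNorm (𝔤 : Ideal (𝓞 K)) : ℝ) ^ 2)⁻¹) =
      1 / ∑ 𝔤 ∈ hℛ.finite.toFinset, (((Ideal.absNorm (𝔤 : Ideal (𝓞 K)) : ℝ) ^ 2)⁻¹) := by
    rw [← Finset.mul_sum, OneMemClass.coe_one, map_one]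
    field_simp
    simp
  rw [hval] at hT
  refine hT.congr' ?_
  filter_upwards [eventually_gt_atTop 0] with N hN
  rw [hcop, hwrt, Pi.div_apply, ← Finset.sum_div, div_div_div_cancel_right₀ (by positivity)]

/-- Splits off the trivial ideal, which is the representative of the principal class. The set `T`
consists of the remaining representatives. -/
theorem IsRepresentativeSystem.sum_eq_one_add (hℛ : IsRepresentativeSystem ℛ)
    (hins : ∀ 𝔤 ∈ ℛ, IsInseverable (𝔤 : Ideal (𝓞 K))) (f : (Ideal (𝓞 K))⁰ → ℝ)
    (hf : f 1 = 1) :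
    ∃ T : Finset (Ideal (𝓞 K))⁰, (∀ 𝔤 ∈ T, 𝔤 ∈ ℛ ∧ ¬ (𝔤 : Ideal (𝓞 K)).IsPrincipal) ∧
      (T.card : ℝ) = classNumber K - 1 ∧
      ∑ 𝔤 ∈ hℛ.finite.toFinset, f 𝔤 = 1 + ∑ 𝔤 ∈ T, f 𝔤 := by
  classical
  have h1mem : (1 : (Ideal (𝓞 K))⁰) ∈ hℛ.finite.toFinset :=
    hℛ.finite.mem_toFinset.2 (hℛ.one_mem hins)
  refine ⟨hℛ.finite.toFinset.erase 1, fun 𝔤 h => ?_, ?_, ?_⟩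
  · obtain ⟨hne, hmem⟩ := Finset.mem_erase.1 h
    have hmem' := hℛ.finite.mem_toFinset.1 hmem
    exact ⟨hmem', fun hp => hne (eq_one_of_isPrincipal hins hmem' hp)⟩
  · rw [← hℛ.card_toFinset, ← Finset.card_erase_add_one h1mem]
    push_cast
    ring
  · rw [← Finset.add_sum_erase _ _ h1mem, hf]

/-- Minkowski's bound for the smallest norm in an ideal class, inverted and squared. -/
theorem minkowski_sq_le_inv_absNorm_sq {𝔤 : (Ideal (𝓞 K))⁰} (h : HasMinimalNorm 𝔤) :
    1 / |(discr K : ℝ)| *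
      (((Module.finrank ℚ K : ℝ) ^ Module.finrank ℚ K *
          Real.pi ^ InfinitePlace.nrComplexPlaces K) /
        ((Nat.factorial (Module.finrank ℚ K) : ℝ) *
          4 ^ InfinitePlace.nrComplexPlaces K)) ^ 2 ≤
      (((Ideal.absNorm (𝔤 : Ideal (𝓞 K)) : ℝ) ^ 2)⁻¹) := by
  obtain ⟨I, hI, hle⟩ := exists_ideal_in_class_of_norm_le (ClassGroup.mk0 𝔤)
  have h1 : (Ideal.absNorm (𝔤 : Ideal (𝓞 K)) : ℝ) ≤ _ := (Nat.cast_le.2 (h I hI)).trans hle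
  have h0 : (0 : ℝ) < Ideal.absNorm (𝔤 : Ideal (𝓞 K)) :=
    Nat.cast_pos.2 (Ideal.absNorm_pos_of_nonZeroDivisors 𝔤)
  have hd : 0 < |(discr K : ℝ)| := abs_pos.2 (Int.cast_ne_zero.2 (discr_ne_zero K))
  have hn : (0 : ℝ) < Module.finrank ℚ K := Nat.cast_pos.2 Module.finrank_pos
  refine le_trans (le_of_eq ?_) (inv_anti₀ (by positivity) (pow_le_pow_left₀ h0.le h1 2))
  rw [mul_pow, mul_pow, Real.sq_sqrt hd.le, div_pow 4 Real.pi]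
  field_simp

end Representatives

end NumberFieldFractions

theorem mainTheorem2 (K : Type*) [Field K] [NumberField K]
    (ℛ : Set (Ideal (𝓞 K))⁰)
    (hℛ : NumberFieldFractions.IsRepresentativeSystem ℛ)
    (hins : ∀ 𝔤 ∈ ℛ, IsInseverable (𝔤 : Ideal (𝓞 K))) :
    ∃ δ : ℝ,
      HasNaturalDensity NumberFieldFractions.FractionPair.kappa
        (NumberFieldFractions.reducedFractionsWrt ℛ)
        (NumberFieldFractions.coprimeFractions K) δ ∧
      4 / (3 + (classNumber K : ℝ)) ≤ δ ∧
      (∀ B : ℕ,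
        (∀ 𝔞 : Ideal (𝓞 K), ¬ 𝔞.IsPrincipal → ¬ Ideal.absNorm 𝔞 ≤ B) →
          ((B : ℝ) + 1) ^ 2 / ((B : ℝ) ^ 2 + 2 * (B : ℝ) + (classNumber K : ℝ)) ≤ δ) ∧
      ((∀ 𝔤 ∈ ℛ, NumberFieldFractions.HasMinimalNorm 𝔤) →
        δ ≤ 1 / (1 + ((classNumber K : ℝ) - 1) / |(discr K : ℝ)| *
          (((Module.finrank ℚ K : ℝ) ^ Module.finrank ℚ K *
              Real.pi ^ InfinitePlace.nrComplexPlaces K) /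
            ((Nat.factorial (Module.finrank ℚ K) : ℝ) *
              4 ^ InfinitePlace.nrComplexPlaces K)) ^ 2)) := by
  obtain ⟨T, hT, hcard, hsum⟩ := hℛ.sum_eq_one_add hins
    (fun 𝔤 => (((Ideal.absNorm (𝔤 : Ideal (𝓞 K)) : ℝ) ^ 2)⁻¹)) (by simp)
  -- The class number is at least `1`, being one more than the number of non-principal representatives.
  have hh : (0 : ℝ) ≤ classNumber K - 1 := hcard ▸ Nat.cast_nonneg _
  have hpos : 0 < 1 + ∑ 𝔤 ∈ T, (((Ideal.absNorm (𝔤 : Ideal (𝓞 K)) : ℝ) ^ 2)⁻¹) :=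
    add_pos_of_pos_of_nonneg one_pos (Finset.sum_nonneg fun _ _ => by positivity)
  have hB : ∀ B : ℕ,
      (∀ 𝔞 : Ideal (𝓞 K), ¬ 𝔞.IsPrincipal → ¬ Ideal.absNorm 𝔞 ≤ B) →
        ((B : ℝ) + 1) ^ 2 / ((B : ℝ) ^ 2 + 2 * (B : ℝ) + (classNumber K : ℝ)) ≤
          1 / (1 + ∑ 𝔤 ∈ T, (((Ideal.absNorm (𝔤 : Ideal (𝓞 K)) : ℝ) ^ 2)⁻¹)) := by
    intro B hB
    have hle : ∑ 𝔤 ∈ T, (((Ideal.absNorm (𝔤 : Ideal (𝓞 K)) : ℝ) ^ 2)⁻¹) ≤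
        ((classNumber K : ℝ) - 1) * ((((B : ℝ) + 1) ^ 2)⁻¹) := by
      rw [← hcard, ← nsmul_eq_mul]
      refine Finset.sum_le_card_nsmul _ _ _ fun 𝔤 h𝔤 => ?_
      have hlt : B + 1 ≤ Ideal.absNorm (𝔤 : Ideal (𝓞 K)) := not_le.1 (hB _ (hT 𝔤 h𝔤).2)
      gcongr
      exact_mod_cast hlt
    have heq : ((B : ℝ) + 1) ^ 2 / ((B : ℝ) ^ 2 + 2 * (B : ℝ) + (classNumber K : ℝ)) =
        1 / (1 + ((classNumber K : ℝ) - 1) * ((((B : ℝ) + 1) ^ 2)⁻¹)) := by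
      have : (0 : ℝ) < (B : ℝ) ^ 2 + 2 * (B : ℝ) + (classNumber K : ℝ) := by nlinarith
      have h1 : (0 : ℝ) < 1 + ((classNumber K : ℝ) - 1) * ((((B : ℝ) + 1) ^ 2)⁻¹) := by positivity
      rw [div_eq_div_iff this.ne' h1.ne']
      field_simp
      ring
    rw [heq]
    exact one_div_le_one_div_of_le hpos (by gcongr)
  refine ⟨_, NumberFieldFractions.hasNaturalDensity_coprimeFractions hℛ hins, ?_, ?_, ?_⟩
  · rw [hsum]
    -- This is the case `B = 1` of the next bound: ideals of norm `0` and `1` are principal.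
    refine le_trans (le_of_eq ?_) (hB 1 fun 𝔞 hp hle => ?_)
    · norm_num
    · have : Ideal.absNorm 𝔞 = 0 ∨ Ideal.absNorm 𝔞 = 1 := by omega
      rcases this with h | h
      · exact hp (Ideal.absNorm_eq_zero_iff.1 h ▸ bot_isPrincipal)
      · exact hp (Ideal.absNorm_eq_one_iff.1 h ▸ top_isPrincipal)
  · rw [hsum]
    exact hB
  · intro hmin
    rw [hsum]
    refine one_div_le_one_div_of_le (by positivity) ?_
    rw [div_eq_mul_one_div, mul_assoc, ← hcard, ← nsmul_eq_mul]
    gcongr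
    exact Finset.card_nsmul_le_sum _ _ _ fun 𝔤 h𝔤 =>
      NumberFieldFractions.minkowski_sq_le_inv_absNorm_sq (hmin 𝔤 (hT 𝔤 h𝔤).1)
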